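/- All graphs are finite and simple. A \emph{cover} of a graph $G$ is a pair $\mathcal H=(L,H)$, where $H$ is a graph and $L\colon V(G)\to 2^{V(H)}$, such that: the sets $L(u)$, $u\in V(G)$, partition $V(H)$; each $L(u)$ induces a complete subgraph of $H$; if $H$ has an edge between $L(u)$ and $L(v)$, then $u=v$ or $uv\in E(G)$; and if $uv\in E(G)$, then the edges of $H$ between $L(u)$ and $L(v)$ form a (possibly empty, not necessarily perfect) matching. The cover is \emph{$k$-fold} if $|L(u)|=k$ for all $u\in V(G)$. For $\eta\in[0,1]$, an \emph{$(\eta,\mathcal H)$-coloring} of $G$ is a set $S\subseteq V(H)$ such that no edge of $H$ between distinct parts $L(u)$, $L(v)$ has both endpoints in $S$, and $|S\cap L(u)|\ge \eta|L(u)|$ for all $u\in V(G)$. For $k\in\mathbb N^+$ let \[ \theta_{DP}(G,k)=\max\{\eta\in[0,1] : G \text{ admits an } (\eta,\mathcal H)\text{-coloring for every } k\text{-fold cover } \mathcal H \text{ of } G\}, \] and let the \emph{fractional DP-chromatic number} of $G$ be $\chi^\ast_{DP}(G)=\inf\{\theta_{DP}(G,k)^{-1} : k\in\mathbb N^+\}$,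 where $0^{-1}=\infty$. \textbf{Corollary.} There is a function $\varepsilon\colon\mathbb N\to\mathbb R$ with $\varepsilon(d)\to 0$ as $d\to\infty$ such that for all $d,g\in\mathbb N^+$ there exists a graph $G_{d,g}$ with chromatic number at least $d$, girth at least $g$ (an acyclic graph having girth $\infty$), and, if $d\ge 2$, \[ \chi^\ast_{DP}(G_{d,g})\le (1+\varepsilon(d))\,\frac{d}{\ln d}. \] -/

import Mathlib

/-- A cover `(L, H)` of a graph `G`, the vertex set of the graph `H` being the type `W`. -/
structure DPCover {V : Type*} (G : SimpleGraph V) (W : Type*) where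
  /-- The graph `H`. -/
  H : SimpleGraph W
  /-- The function `L`, assigning to each vertex of `G` a set of vertices of `H`. -/
  L : V → Set W
  /-- The sets `L u` partition the vertex set of `H`. -/
  partition : ∀ x : W, ∃! u : V, x ∈ L u
  /-- Each `L u` induces a complete subgraph of `H`. -/
  complete : ∀ u : V, H.IsClique (L u)
  /-- Edges of `H` run only inside a part or between parts of adjacent vertices of `G`. -/
  eq_or_adj : ∀ u v : V, ∀ x ∈ L u, ∀ y ∈ L v, H.Adj x y → u = v ∨ G.Adj u v
  /-- For an edge `uv` of `G`, the edges of `H` between `L u` and `L v` form a matching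
  (as `G.Adj` is symmetric, the condition applies to both sides). -/
  matching : ∀ u v : V, G.Adj u v →
    ∀ x ∈ L u, ∀ y ∈ L v, ∀ y' ∈ L v, H.Adj x y → H.Adj x y' → y = y'

namespace DPCover

variable {V W : Type*} {G : SimpleGraph V}

/-- A cover is `k`-fold if `|L u| = k` for all vertices `u`. -/
def IsFold (C : DPCover G W) (k : ℕ) : Prop :=
  ∀ u : V, (C.L u).ncard = k

/-- `xy` is a cross-edge: an edge of `H` connecting distinct parts. -/
def IsCrossEdge (C : DPCover G W) (x y : W) : Prop :=
  C.H.Adj x y ∧ ∃ u v : V, u ≠ v ∧ x ∈ C.L u ∧ y ∈ C.L v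

/-- A set of vertices of `H` is quasi-independent if it spans no cross-edges. -/
def IsQuasiIndep (C : DPCover G W) (S : Set W) : Prop :=
  ∀ x ∈ S, ∀ y ∈ S, ¬ C.IsCrossEdge x y

/-- `S` is an `(η, (L, H))`-coloring of `G`. -/
def IsFracColoring (C : DPCover G W) (η : ℝ) (S : Set W) : Prop :=
  C.IsQuasiIndep S ∧ ∀ u : V, η * ((C.L u).ncard : ℝ) ≤ ((S ∩ C.L u).ncard : ℝ)

end DPCover

/-- `θ_DP(G, k)`: the largest `η ∈ [0, 1]` such that `G` admits an `(η, 𝓗)`-coloring for every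
`k`-fold cover `𝓗` of `G`. The set contains `0`. -/
noncomputable def thetaDP {V : Type*} (G : SimpleGraph V) (k : ℕ) : ℝ :=
  sSup {η : ℝ | η ∈ Set.Icc (0 : ℝ) 1 ∧
    ∀ (W : Type) [Finite W] (C : DPCover G W), C.IsFold k → ∃ S : Set W, C.IsFracColoring η S}

/-- The fractional DP-chromatic number `inf {θ_DP(G, k)⁻¹ : k ≥ 1}`. It is computed in `[0, ∞]`,
since `θ_DP(G, k)` may vanish for some `k`, in which case its inverse is `∞`. -/
noncomputable def fracDPChromaticNumber {V : Type*} (G : SimpleGraph V) : ENNReal :=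
  ⨅ k : ℕ+, (ENNReal.ofReal (thetaDP G k))⁻¹

/-!
Call an acyclic digraph a multitree if distinct out-neighbours of a vertex reach disjoint sets of
vertices. Starting from one vertex, the Descartes construction over sparse Ramsey hypergraphs
(obtained by partite amalgamation) raises the chromatic number by one, adds one out-neighbour to
every vertex and preserves the girth and the multitree property. So there are multitrees of large
girth which are not `n`-colourable although all out-degrees are at most `n`.

If a multitree orients `G`, its lift to the cross-edges of a cover of `G` is again a multitree,
and distinct elements of a list reach disjoint sets. Decide greedily, from the sinks up, which
vertices of the lift to select: a vertex none of whose out-neighbours are selected passes an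
independent coin flip. In a multitree the selections of the out-neighbours are independent, so if
`p ≤ (1 - p) ^ D`, where `D` bounds the out-degrees, the coins can be biased to select every
vertex with probability exactly `p`. As the selections within a list are independent as well,
Chebyshev's inequality shows that a random selection uses a proportion close to `p` of all lists
of a `k`-fold cover once `k` is large, whence `χ*_DP(G) ≤ 1 / p`. The best `p` is asymptotically
`ln D / D`.
-/

/-! ### Graphs without short cycles -/

section Sparse

variable {V V' : Type*} {G : SimpleGraph V} {G' : SimpleGraph V'} {s : Set V} {g : ℕ}

/-- A set of vertices inducing a subgraph of minimum degree at least `2`. -/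
def IsCore (G : SimpleGraph V) (U : Finset V) : Prop :=
  ∀ v ∈ U, (G.neighborSet v ∩ U).Nontrivial

/-- `G` has no cycle of length less than `g` inside `s`. This is expressed by cores: a cycle is a
core and a core contains a cycle, but cores are easier to restrict and to push forward. -/
def IsSparseOn (G : SimpleGraph V) (s : Set V) (g : ℕ) : Prop :=
  ∀ U : Finset V, ↑U ⊆ s → U.Nonempty → IsCore G U → g ≤ U.card

-- Deleting the exceptional vertex leaves at most one new vertex of degree less than two.
theorem IsSparseOn.le_card_of_subsingleton (h : IsSparseOn G s g) {T : Set V} {U : Finset V}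
    (hT : T.Subsingleton) (hUs : ↑U ⊆ s) (hU : (U : Set V).Nontrivial)
    (hdeg : ∀ v ∈ U, v ∉ T → (G.neighborSet v ∩ U).Nontrivial) : g ≤ U.card := by
  classical
  induction U using Finset.strongInduction generalizing T with
  | H U ih =>
    by_cases hcore : IsCore G U
    · exact h U hUs hU.nonempty hcore
    unfold IsCore at hcore
    push Not at hcore
    obtain ⟨w, hw, hsub⟩ := hcore
    have hwT : w ∈ T := by
      by_contra hwT
      exact Set.not_nontrivial_iff.mpr hsub (hdeg w hw hwT)
    have hdeg' : ∀ v ∈ U.erase w, v ∉ G.neighborSet w ∩ U →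
        (G.neighborSet v ∩ ↑(U.erase w)).Nontrivial := by
      intro v hv hvw
      obtain ⟨hne, hvU⟩ := Finset.mem_erase.mp hv
      refine (hdeg v hvU fun hvT => hne (hT hvT hwT)).mono fun x hx => ⟨hx.1, ?_⟩
      refine Finset.mem_coe.mpr (Finset.mem_erase.mpr ⟨?_, hx.2⟩)
      rintro rfl
      exact hvw ⟨G.adj_symm hx.1, hvU⟩
    have herase : (↑(U.erase w) : Set V).Nontrivial := by
      obtain ⟨v, hv, hvw⟩ := hU.exists_ne w
      have hvT : v ∉ T := fun hvT => hvw (hT hvT hwT)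
      by_cases hadj : G.Adj w v
      · obtain ⟨a, ha, haw⟩ := (hdeg v hv hvT).exists_ne w
        exact ⟨v, by simp [hv, hvw], a, by simpa [haw] using ha.2, (G.ne_of_adj ha.1)⟩
      · refine (hdeg' v (by simp [hvw, Finset.mem_coe.mp hv]) fun hv' => hadj hv'.1).mono
          Set.inter_subset_right
    exact (ih _ (Finset.erase_ssubset hw) hsub
      ((Finset.coe_subset.mpr (Finset.erase_subset w U)).trans hUs) herase hdeg').trans
      (Finset.card_erase_le)

theorem IsSparseOn.range (h : IsSparseOn G Set.univ g) (f : V → V')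
    (hf : ∀ a b, G'.Adj (f a) (f b) → G.Adj a b) : IsSparseOn G' (Set.range f) g := by
  classical
  intro U hU hne hcore
  obtain ⟨x₀, hx₀⟩ := hne
  have : Nonempty V := ⟨(hU hx₀).choose⟩
  choose! k hk using fun x (hx : x ∈ U) => hU hx
  refine (h (U.image k) (Set.subset_univ _) ⟨k x₀, Finset.mem_image_of_mem k hx₀⟩ ?_).trans
    Finset.card_image_le
  refine Finset.forall_mem_image.mpr fun u hu => ?_
  obtain ⟨a, ⟨hua, ha⟩, b, ⟨hub, hb⟩, hab⟩ := hcore u hu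
  have hadj : ∀ x ∈ U, G'.Adj u x → G.Adj (k u) (k x) := fun x hx hux =>
    hf _ _ (by rwa [hk u hu, hk x hx])
  refine ⟨k a, ⟨hadj a ha hua, by simpa using ⟨a, ha, rfl⟩⟩,
    k b, ⟨hadj b hb hub, by simpa using ⟨b, hb, rfl⟩⟩, fun hkab => hab ?_⟩
  rw [← hk a ha, hkab, hk b hb]

theorem IsSparseOn.le_egirth (h : IsSparseOn G Set.univ g) : (g : ℕ∞) ≤ G.egirth := by
  classical
  rw [SimpleGraph.le_egirth]
  intro a w hw
  have hcore : IsCore G w.support.toFinset := by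
    intro v hv
    have hv : v ∈ w.support := List.mem_toFinset.mp hv
    have hc := hw.rotate hv
    have hmem : ∀ i, (w.rotate v hv).getVert i ∈ w.support.toFinset := fun i =>
      List.mem_toFinset.mpr
        ((SimpleGraph.Walk.mem_support_rotate_iff w v hv).mp
          ((w.rotate v hv).getVert_mem_support i))
    exact ⟨_, ⟨SimpleGraph.Walk.adj_snd hc.not_nil, hmem _⟩,
      _, ⟨(SimpleGraph.Walk.adj_penultimate hc.not_nil).symm, hmem _⟩, hc.snd_ne_penultimate⟩
  have hcard : w.support.toFinset.card ≤ w.length := by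
    have hsupp : w.support.toFinset = w.support.tail.toFinset := by
      rw [← w.cons_tail_support, List.toFinset_cons, List.tail_cons, Finset.insert_eq_self]
      exact List.mem_toFinset.mpr (SimpleGraph.Walk.end_mem_tail_support hw.not_nil)
    rw [hsupp]
    exact (List.toFinset_card_le _).trans (by simp)
  exact_mod_cast (h _ (Set.subset_univ _) ⟨a, by simp⟩ hcore).trans hcard

end Sparse

section Incidence

variable {X J R Z : Type*} {e : J → R → X}

/-- The incidence graph between the points `X` and the edges `J` of a hypergraph whose edges are
parametrised by `e`. -/
def incidenceGraph (e : J → R → X) : SimpleGraph (X ⊕ J) where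
  Adj
    | .inl x, .inr j => ∃ r, e j r = x
    | .inr j, .inl x => ∃ r, e j r = x
    | _, _ => False
  symm := ⟨by rintro (x | j) (y | k) h <;> exact h⟩
  loopless := ⟨by rintro (x | j) h <;> exact h⟩

theorem incidenceGraph_adj_inl {x : X} {m : X ⊕ J} :
    (incidenceGraph e).Adj (.inl x) m ↔ ∃ j r, m = .inr j ∧ e j r = x := by
  rcases m with y | j <;> simp [incidenceGraph]

theorem incidenceGraph_adj_inr {j : J} {m : X ⊕ J} :
    (incidenceGraph e).Adj (.inr j) m ↔ ∃ r, m = .inl (e j r) := by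
  rcases m with y | k <;> simp [incidenceGraph, eq_comm]

/-- `β` maps `G` onto the incidence graph of a hypergraph by contracting disjoint clusters of
vertices, one for each edge of the hypergraph, while each point of the hypergraph comes from at most
one vertex; a vertex of a cluster is attached to at most one point. -/
structure IsClusterMap (G : SimpleGraph Z) (e : J → R → X) (β : Z → X ⊕ J) : Prop where
  injOn : Set.InjOn β (β ⁻¹' Set.range Sum.inl)
  eq_or_adj : ∀ {z z'}, G.Adj z z' → β z = β z' ∨ (incidenceGraph e).Adj (β z) (β z')
  attached_subsingleton : ∀ {z j}, β z = .inr j →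
    (G.neighborSet z ∩ β ⁻¹' Set.range Sum.inl).Subsingleton

namespace IsClusterMap

variable {G : SimpleGraph Z} {β : Z → X ⊕ J} {g : ℕ} {U : Finset Z}

/-- The clusters that the vertex `y` has neighbours in, within `U`. -/
def clustersAt (G : SimpleGraph Z) (β : Z → X ⊕ J) (U : Finset Z) (y : Z) : Set J :=
  {j | ∃ z ∈ U, G.Adj y z ∧ β z = .inr j}

/-- The points in which at least two clusters are joined together within `U`. -/
def junctions (G : SimpleGraph Z) (β : Z → X ⊕ J) (U : Finset Z) : Set Z :=
  {y ∈ U | β y ∈ Set.range Sum.inl ∧ (clustersAt G β U y).Nontrivial}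

theorem exists_map_eq_inr_of_adj (h : IsClusterMap G e β) {y z : Z} (hyz : G.Adj y z)
    (hy : β y ∈ Set.range Sum.inl) :
    ∃ j, β z = .inr j ∧ (incidenceGraph e).Adj (β y) (.inr j) := by
  rcases h.eq_or_adj hyz with heq | hadj
  · exact absurd (h.injOn hy (by simpa [← heq] using hy) heq) hyz.ne
  · obtain ⟨x, hx⟩ := hy
    rw [← hx] at hadj ⊢
    obtain ⟨j, -, hj, -⟩ := incidenceGraph_adj_inl.mp hadj
    exact ⟨j, hj, hj ▸ hadj⟩

theorem mem_clustersAt_adj (h : IsClusterMap G e β) {y : Z} {j : J}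
    (hy : β y ∈ Set.range Sum.inl) (hj : j ∈ clustersAt G β U y) :
    (incidenceGraph e).Adj (β y) (.inr j) := by
  obtain ⟨z, -, hyz, hz⟩ := hj
  obtain ⟨j', hj', hadj⟩ := h.exists_map_eq_inr_of_adj hyz hy
  rwa [Sum.inr_injective (hj'.symm.trans hz)] at hadj

open Classical in
/-- The image in the incidence graph of the clusters and the junctions of `U`. -/
noncomputable def contraction (G : SimpleGraph Z) (β : Z → X ⊕ J) (U : Finset Z) :
    Finset (X ⊕ J) :=
  (U.filter fun v => β v ∈ Set.range Sum.inr ∨ v ∈ junctions G β U).image β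

theorem junctions_nontrivial (h : IsClusterMap G e β) (hU : IsCore G U) (hcard : U.card < g)
    {j : J} (hsparse : IsSparseOn G {z | β z = .inr j ∨ (incidenceGraph e).Adj (β z) (.inr j)} g)
    {z : Z} (hz : z ∈ U) (hzj : β z = .inr j) :
    {y ∈ junctions G β U | j ∈ clustersAt G β U y}.Nontrivial := by
  classical
  by_contra hT
  let star := U.filter fun v =>
    β v = .inr j ∨ β v ∈ Set.range Sum.inl ∧ j ∈ clustersAt G β U v
  have mem_star_of_cluster : ∀ v ∈ U, β v = .inr j →
      G.neighborSet v ∩ U ⊆ G.neighborSet v ∩ star := by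
    rintro v hv hvj a ⟨hva, ha⟩
    refine ⟨hva, Finset.mem_filter.mpr ⟨ha, ?_⟩⟩
    rcases h.eq_or_adj hva with heq | hadj
    · exact .inl (heq ▸ hvj)
    · rw [hvj] at hadj
      obtain ⟨r, hr⟩ := incidenceGraph_adj_inr.mp hadj
      exact .inr ⟨⟨_, hr.symm⟩, v, hv, G.adj_symm hva, hvj⟩
  have hdeg : ∀ v ∈ star, v ∉ {y ∈ junctions G β U | j ∈ clustersAt G β U y} →
      (G.neighborSet v ∩ star).Nontrivial := by
    intro v hv hvT
    obtain ⟨hvU, hvj | ⟨hpt, hvj⟩⟩ := Finset.mem_filter.mp hv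
    · exact (hU v hvU).mono (mem_star_of_cluster v hvU hvj)
    · refine (hU v hvU).mono fun a ⟨hva, ha⟩ => ⟨hva, Finset.mem_filter.mpr ⟨ha, .inl ?_⟩⟩
      obtain ⟨i, hai, -⟩ := h.exists_map_eq_inr_of_adj hva hpt
      by_contra hne
      refine hvT ⟨⟨hvU, hpt, j, hvj, i, ⟨a, ha, hva, hai⟩, ?_⟩, hvj⟩
      rintro rfl
      exact hne hai
  have hle : g ≤ star.card := by
    refine hsparse.le_card_of_subsingleton (Set.not_nontrivial_iff.mp hT) ?_ ?_ hdeg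
    · intro v hv
      exact (Finset.mem_filter.mp hv).2.imp_right fun hv => h.mem_clustersAt_adj hv.1 hv.2
    · exact (hU z hz).mono ((mem_star_of_cluster z hz hzj).trans Set.inter_subset_right)
  exact (hle.trans (Finset.card_filter_le _ _)).not_gt hcard

theorem not_injOn (h : IsClusterMap G e β) {j : J}
    (hj : {y ∈ junctions G β U | j ∈ clustersAt G β U y}.Nontrivial) : ¬ Set.InjOn β U := by
  obtain ⟨y, ⟨hy, z, hz, hyz, hzj⟩, y', ⟨hy', z', hz', hyz', hzj'⟩, hne⟩ := hj
  refine fun hinj => hne ?_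
  obtain rfl : z = z' := hinj hz hz' (hzj.trans hzj'.symm)
  exact h.attached_subsingleton hzj ⟨hyz.symm, hy.2.1⟩ ⟨hyz'.symm, hy'.2.1⟩

theorem isCore_contraction (h : IsClusterMap G e β)
    (hjunc : ∀ z ∈ U, ∀ j, β z = .inr j →
      {y ∈ junctions G β U | j ∈ clustersAt G β U y}.Nontrivial) :
    IsCore (incidenceGraph e) (contraction G β U) := by
  classical
  have mem_of_junction {y : Z} (hy : y ∈ junctions G β U) : β y ∈ contraction G β U :=
    Finset.mem_image_of_mem β (Finset.mem_filter.mpr ⟨hy.1, .inr hy⟩)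
  have mem_of_cluster {y : Z} {i : J} (hi : i ∈ clustersAt G β U y) :
      .inr i ∈ contraction G β U := by
    obtain ⟨a, ha, -, hai⟩ := hi
    exact Finset.mem_image.mpr ⟨a, Finset.mem_filter.mpr ⟨ha, .inl ⟨i, hai.symm⟩⟩, hai⟩
  refine Finset.forall_mem_image.mpr fun v hv => ?_
  obtain ⟨hvU, ⟨i, hi⟩ | hv⟩ := Finset.mem_filter.mp hv
  · obtain ⟨y, ⟨hy, hyi⟩, y', ⟨hy', hyi'⟩, hne⟩ := hjunc v hvU i hi.symm
    rw [← hi]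
    exact ⟨β y, ⟨(h.mem_clustersAt_adj hy.2.1 hyi).symm, mem_of_junction hy⟩,
      β y', ⟨(h.mem_clustersAt_adj hy'.2.1 hyi').symm, mem_of_junction hy'⟩,
      fun heq => hne (h.injOn hy.2.1 hy'.2.1 heq)⟩
  · obtain ⟨-, hpt, i, hi, i', hi', hne⟩ := hv
    exact ⟨.inr i, ⟨h.mem_clustersAt_adj hpt hi, mem_of_cluster hi⟩,
      .inr i', ⟨h.mem_clustersAt_adj hpt hi', mem_of_cluster hi'⟩, Sum.inr_injective.ne hne⟩

-- The girth goes up by one: two junctions on one cluster are attached to different vertices of it,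
-- so the contraction of a core is a strictly smaller core.
theorem isSparseOn (h : IsClusterMap G e β) (he : IsSparseOn (incidenceGraph e) Set.univ g)
    (hcluster : ∀ j, IsSparseOn G
      {z | β z = .inr j ∨ (incidenceGraph e).Adj (β z) (.inr j)} (g + 1)) :
    IsSparseOn G Set.univ (g + 1) := by
  classical
  intro U _ ⟨v, hv⟩ hU
  by_contra! hcard
  have hjunc : ∀ z ∈ U, ∀ j, β z = .inr j →
      {y ∈ junctions G β U | j ∈ clustersAt G β U y}.Nontrivial := fun z hz j =>
    h.junctions_nontrivial hU hcard (hcluster j) hz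
  obtain ⟨z, hz, j, hzj⟩ : ∃ z ∈ U, ∃ j, β z = .inr j := by
    rcases hβ : β v with x | j
    · obtain ⟨a, ⟨hva, ha⟩, -⟩ := hU v hv
      obtain ⟨j, hj, -⟩ := h.exists_map_eq_inr_of_adj hva ⟨x, hβ.symm⟩
      exact ⟨a, ha, j, hj⟩
    · exact ⟨v, hv, j, hβ⟩
  have hlt : (U.image β).card < U.card := Finset.card_image_le.lt_of_ne fun heq =>
    h.not_injOn (hjunc z hz j hzj) (Finset.card_image_iff.mp heq)
  have hle : (contraction G β U).card ≤ (U.image β).card :=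
    Finset.card_le_card (Finset.image_subset_image (Finset.filter_subset _ U))
  have hne : (contraction G β U).Nonempty :=
    ⟨_, Finset.mem_image_of_mem β (Finset.mem_filter.mpr ⟨hz, .inl ⟨j, hzj.symm⟩⟩)⟩
  have := he _ (Set.subset_univ _) hne (h.isCore_contraction hjunc)
  lia

end IsClusterMap

end Incidence

/-! ### Sparse Ramsey hypergraphs -/

section Ramsey

theorem exists_embedding_monochromatic {C R : Type*} [Finite C] [Nonempty C] [Finite R]
    (f : C × R → C) : ∃ j : R ↪ C × R, ∀ r t, f (j r) = f (j t) := by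
  classical
  have := Fintype.ofFinite C
  have := Fintype.ofFinite R
  obtain ⟨c, hc⟩ := Fintype.exists_le_card_fiber_of_mul_le_card (f := f) (n := Fintype.card R)
    (by rw [Fintype.card_prod])
  rw [← Fintype.card_subtype] at hc
  obtain ⟨j⟩ := Function.Embedding.nonempty_of_card_le hc
  exact ⟨j.trans (Function.Embedding.subtype _), fun r t => (j r).2.trans (j t).2.symm⟩

/-- Hypergraphs of every uniformity whose incidence graphs have no cycles of length less than
`g` and that have a monochromatic edge in every colouring. -/
def HasSparseRamseyHypergraphs (g : ℕ) : Prop :=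
  ∀ (R C : Type) [Finite R] [Finite C] [Nonempty C],
    ∃ (X J : Type) (_ : Finite X) (_ : Finite J) (e : J → R → X),
      (∀ j, Function.Injective (e j)) ∧ IsSparseOn (incidenceGraph e) Set.univ g ∧
      ∀ f : X → C, ∃ j, ∀ r t, f (e j r) = f (e j t)

/-- A hypergraph with points partitioned by `π` into parts indexed by `A`, each edge meeting every
part at most once, that has a monochromatic edge in every colouring that is constant
on the parts outside `I`. -/
def HasPartiteRamseyHypergraph (g : ℕ) (R C : Type) {A : Type} (I : Finset A) : Prop :=
  ∃ (X J : Type) (_ : Finite X) (_ : Finite J) (e : J → R → X) (π : X → A),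
    (∀ j, Function.Injective (π ∘ e j)) ∧ IsSparseOn (incidenceGraph e) Set.univ g ∧
    ∀ f : X → C, (∀ x y, π x ∉ I → π x = π y → f x = f y) → ∃ j, ∀ r t, f (e j r) = f (e j t)

theorem isSparseOn_incidenceGraph_of_disjoint {X J R : Type*} {e : J → R → X}
    (he : ∀ {j j' r r'}, e j r = e j' r' → j = j') (g : ℕ) :
    IsSparseOn (incidenceGraph e) Set.univ g := by
  intro U _ ⟨v, hv⟩ hU
  have no_point (x : X) : Sum.inl x ∉ U := by
    intro hx
    obtain ⟨a, ⟨ha, -⟩, b, ⟨hb, -⟩, hne⟩ := hU _ hx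
    obtain ⟨j, r, rfl, hj⟩ := incidenceGraph_adj_inl.mp ha
    obtain ⟨j', r', rfl, hj'⟩ := incidenceGraph_adj_inl.mp hb
    exact hne (congrArg Sum.inr (he (hj.trans hj'.symm)))
  obtain ⟨a, ⟨hva, ha⟩, -⟩ := hU v hv
  rcases v with x | j
  · exact absurd hv (no_point x)
  · obtain ⟨r, rfl⟩ := incidenceGraph_adj_inr.mp hva
    exact absurd ha (no_point _)

theorem hasPartiteRamseyHypergraph_empty (g : ℕ) (R C : Type) [Finite R] [Finite C]
    [Nonempty C] : HasPartiteRamseyHypergraph g R C (∅ : Finset (C × R)) := by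
  refine ⟨(R ↪ C × R) × R, R ↪ C × R, inferInstance, inferInstance, fun j r => (j, r),
    fun x => x.1 x.2, fun j => j.injective,
    isSparseOn_incidenceGraph_of_disjoint (fun h => congrArg Prod.fst h) g, fun f hf => ?_⟩
  obtain ⟨c, rfl⟩ := (Function.factorsThrough_iff f).mp fun x y hxy => hf x y (by simp) hxy
  exact exists_embedding_monochromatic c

section Amalgam

variable {X J R A P K : Type*} [DecidableEq A] {e : J → R → X} {π : X → A} {i : A}
  {E : K → X → P}

/-- The `k`-th copy of `X` in the amalgam of copies of `X` along the hypergraph `E`: the points of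
the part `i` form the `k`-th edge of `E`, all other points are new. Some of the points `K × X` of
the amalgam are not used by any copy. -/
def amalgamCopy (π : X → A) (i : A) (E : K → X → P) (k : K) (x : X) : P ⊕ K × X :=
  if π x = i then .inl (E k x) else .inr (k, x)

/-- The partition of the points of an amalgam: the points of `E` form the part `i`. -/
def amalgamPart (π : X → A) (i : A) : P ⊕ K × X → A :=
  Sum.elim (fun _ => i) (π ∘ Prod.snd)

/-- The edges of an amalgam: the edges `e` in every copy. -/
def amalgamEdge (e : J → R → X) (π : X → A) (i : A) (E : K → X → P) (kj : K × J) (r : R) :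
    P ⊕ K × X :=
  amalgamCopy π i E kj.1 (e kj.2 r)

/-- The contraction of the new points and the edges of each copy to an edge of `E`. -/
def amalgamContract : (P ⊕ K × X) ⊕ K × J → P ⊕ K :=
  Sum.elim (Sum.map id Prod.fst) (Sum.inr ∘ Prod.fst)

theorem amalgamPart_copy (k : K) (x : X) : amalgamPart π i (amalgamCopy π i E k x) = π x := by
  unfold amalgamCopy amalgamPart
  split_ifs with h <;> simp [h]

theorem amalgamCopy_injective (hE : ∀ k, Function.Injective (E k)) (k : K) :
    Function.Injective (amalgamCopy π i E k) := by
  intro x y hxy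
  unfold amalgamCopy at hxy
  split_ifs at hxy
  · exact hE k (Sum.inl_injective hxy)
  · exact congrArg Prod.snd (Sum.inr_injective hxy)

theorem isClusterMap_amalgamContract (he : ∀ j, Function.Injective (π ∘ e j)) :
    IsClusterMap (incidenceGraph (amalgamEdge e π i E)) E (amalgamContract (X := X) (J := J)) where
  injOn := by
    rintro ((p | x) | j) ⟨q, hq⟩ ((p' | x') | j') _ hzz <;>
      simp_all [amalgamContract]
  eq_or_adj := by
    have key (k : K) (x : X) :
        amalgamContract (J := J) (.inl (amalgamCopy π i E k x)) = .inr k ∨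
          (incidenceGraph E).Adj (amalgamContract (J := J) (.inl (amalgamCopy π i E k x)))
            (.inr k) := by
      unfold amalgamCopy
      split_ifs
      · exact .inr ⟨x, rfl⟩
      · exact .inl rfl
    rintro (z | ⟨k, j⟩) z' hzz
    · obtain ⟨⟨k, j⟩, r, rfl, rfl⟩ := incidenceGraph_adj_inl.mp hzz
      exact key k _
    · obtain ⟨r, rfl⟩ := incidenceGraph_adj_inr.mp hzz
      exact (key k _).imp Eq.symm SimpleGraph.Adj.symm
  attached_subsingleton := by
    rintro (z | ⟨k, j⟩) k' - a ⟨hza, ha⟩ b ⟨hzb, hb⟩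
    · obtain ⟨_, _, rfl, -⟩ := incidenceGraph_adj_inl.mp hza
      simp [amalgamContract] at ha
    · have mem_part {x : X} (hx : amalgamContract (J := J) (.inl (amalgamCopy π i E k x)) ∈
          Set.range Sum.inl) : π x = i := by
        by_contra hne
        simp [amalgamContract, amalgamCopy, hne] at hx
      obtain ⟨r, rfl⟩ := incidenceGraph_adj_inr.mp hza
      obtain ⟨t, rfl⟩ := incidenceGraph_adj_inr.mp hzb
      rw [he j ((mem_part ha).trans (mem_part hb).symm)]

theorem isSparseOn_amalgam_cluster {g : ℕ} (hE : ∀ k, Function.Injective (E k))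
    (hsparse : IsSparseOn (incidenceGraph e) Set.univ g) (k : K) :
    IsSparseOn (incidenceGraph (amalgamEdge e π i E))
      {z | amalgamContract z = .inr k ∨ (incidenceGraph E).Adj (amalgamContract z) (.inr k)} g := by
  intro U hUk hne hU
  have copy_eq {k' : K} {j : J} (hj : .inr (k', j) ∈ U) : k' = k := by
    rcases hUk hj with h | h
    · exact Sum.inr_injective h
    · exact h.elim
  have reflects (a b : X ⊕ J) (hadj : (incidenceGraph (amalgamEdge e π i E)).Adj
      (Sum.map (amalgamCopy π i E k) (Prod.mk k) a) (Sum.map (amalgamCopy π i E k) (Prod.mk k) b)) :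
      (incidenceGraph e).Adj a b := by
    rcases a with x | j <;> rcases b with y | j'
    · exact hadj
    · exact hadj.imp fun _ hr => amalgamCopy_injective hE k hr
    · exact hadj.imp fun _ hr => amalgamCopy_injective hE k hr
    · exact hadj
  refine hsparse.range _ reflects U (fun z hz => ?_) hne hU
  rcases z with q | ⟨k', j⟩
  · obtain ⟨a, ⟨hqa, ha⟩, -⟩ := hU _ hz
    obtain ⟨⟨k', j⟩, r, rfl, rfl⟩ := incidenceGraph_adj_inl.mp hqa
    obtain rfl := copy_eq ha
    exact ⟨.inl (e j r), rfl⟩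
  · obtain rfl := copy_eq hz
    exact ⟨.inr j, rfl⟩

theorem exists_amalgamEdge_monochromatic {C : Type*} {I : Finset A}
    (hE : ∀ f : P → C, ∃ k, ∀ x y, f (E k x) = f (E k y))
    (he : ∀ f : X → C, (∀ x y, π x ∉ I → π x = π y → f x = f y) →
      ∃ j, ∀ r t, f (e j r) = f (e j t))
    (f : P ⊕ K × X → C)
    (hf : ∀ x y, amalgamPart π i x ∉ insert i I → amalgamPart π i x = amalgamPart π i y →
      f x = f y) :
    ∃ kj, ∀ r t, f (amalgamEdge e π i E kj r) = f (amalgamEdge e π i E kj t) := by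
  obtain ⟨k, hk⟩ := hE (f ∘ Sum.inl)
  obtain ⟨j, hj⟩ := he (f ∘ amalgamCopy π i E k) fun x y hx hxy => by
    by_cases hi : π x = i
    · simpa only [Function.comp_apply, amalgamCopy, if_pos hi, if_pos (hxy ▸ hi)] using hk x y
    · exact hf _ _ (by simp [amalgamPart_copy, hi, hx]) (by simpa only [amalgamPart_copy])
  exact ⟨(k, j), hj⟩

end Amalgam

theorem HasPartiteRamseyHypergraph.insert {g : ℕ} (hg : HasSparseRamseyHypergraphs g)
    {R C A : Type} [Finite C] [Nonempty C] [DecidableEq A] {I : Finset A}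
    (h : HasPartiteRamseyHypergraph (g + 1) R C I) (i : A) :
    HasPartiteRamseyHypergraph (g + 1) R C (insert i I) := by
  obtain ⟨X, J, _, _, e, π, hinj, hsparse, hmono⟩ := h
  obtain ⟨P, K, _, _, E, hE, hEsparse, hEmono⟩ := hg X C
  refine ⟨P ⊕ K × X, K × J, inferInstance, inferInstance, amalgamEdge e π i E, amalgamPart π i,
    fun kj => ?_, ?_, exists_amalgamEdge_monochromatic hEmono hmono⟩
  · simpa only [Function.comp_def, amalgamEdge, amalgamPart_copy] using hinj kj.2
  · exact (isClusterMap_amalgamContract hinj).isSparseOn hEsparse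
      (isSparseOn_amalgam_cluster hE hsparse)

theorem hasSparseRamseyHypergraphs (g : ℕ) : HasSparseRamseyHypergraphs g := by
  induction g with
  | zero =>
    intro R C _ _ _
    exact ⟨C × R, R ↪ C × R, inferInstance, inferInstance, fun j => j, fun j => j.injective,
      fun U _ _ _ => Nat.zero_le _, exists_embedding_monochromatic⟩
  | succ g ih =>
    intro R C _ _ _
    classical
    have := Fintype.ofFinite (C × R)
    have partite (I : Finset (C × R)) : HasPartiteRamseyHypergraph (g + 1) R C I := by
      induction I using Finset.induction_on with
      | empty => exact hasPartiteRamseyHypergraph_empty (g + 1) R C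
      | insert i I _ hI => exact hI.insert ih i
    obtain ⟨X, J, hX, hJ, e, π, hinj, hsparse, hmono⟩ := partite Finset.univ
    exact ⟨X, J, hX, hJ, e, fun j => (hinj j).of_comp, hsparse,
      fun f => hmono f fun x _ hx => absurd (Finset.mem_univ _) hx⟩

end Ramsey

/-! ### Multitrees and the Descartes construction -/

section Descartes

open Relation (ReflTransGen)

variable {V : Type*} {r : V → V → Prop}

/-- A multitree: an acyclic digraph, given by its arc relation, in which the sets of vertices
reachable from distinct out-neighbours of a vertex are disjoint. -/
structure IsMultitree (r : V → V → Prop) : Prop where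
  wellFounded : WellFounded (flip r)
  eq_of_reach : ∀ {v w w' z}, r v w → r v w' → ReflTransGen r w z → ReflTransGen r w' z → w = w'

theorem IsMultitree.not_reach (hr : IsMultitree r) {v w : V} (hvw : r v w) :
    ¬ ReflTransGen r w v := fun hwv =>
  hr.wellFounded.transGen.irrefl.irrefl v (Relation.transGen_swap.mpr (.head' hvw hwv))

theorem IsMultitree.fromRel_adj_of_rel (hr : IsMultitree r) {v w : V} (hvw : r v w) :
    (SimpleGraph.fromRel r).Adj v w :=
  ⟨fun h => hr.not_reach hvw (h ▸ .refl), .inl hvw⟩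

variable {X J : Type*} {e : J → V → X}

/-- The arcs of the Descartes construction: for every edge `j` of the hypergraph `e`, a new copy of
the digraph `r` whose vertices send one arc each to the points of `j`. -/
def descartesArc (r : V → V → Prop) (e : J → V → X) : X ⊕ J × V → X ⊕ J × V → Prop
  | .inl _, _ => False
  | .inr (j, v), .inl x => e j v = x
  | .inr (j, v), .inr (j', w) => j = j' ∧ r v w

theorem descartesArc_inr {j : J} {v : V} {z : X ⊕ J × V} :
    descartesArc r e (.inr (j, v)) z ↔ z = .inl (e j v) ∨ ∃ w, r v w ∧ z = .inr (j, w) := by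
  rcases z with x | ⟨j', w⟩ <;> simp [descartesArc, eq_comm, and_comm]

theorem reach_descartesArc_inl {x : X} {z : X ⊕ J × V}
    (h : ReflTransGen (descartesArc r e) (.inl x) z) : z = .inl x := by
  rcases h.cases_head with h | ⟨_, h, -⟩
  · exact h.symm
  · exact h.elim

theorem reach_descartesArc_inr {j : J} {v : V} {z : X ⊕ J × V}
    (h : ReflTransGen (descartesArc r e) (.inr (j, v)) z) :
    ∃ u, ReflTransGen r v u ∧ (z = .inr (j, u) ∨ z = .inl (e j u)) := by
  induction h with
  | refl => exact ⟨v, .refl, .inl rfl⟩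
  | tail _ harc ih =>
    obtain ⟨u, hvu, rfl | rfl⟩ := ih
    · rcases descartesArc_inr.mp harc with rfl | ⟨w, huw, rfl⟩
      · exact ⟨u, hvu, .inr rfl⟩
      · exact ⟨w, hvu.tail huw, .inl rfl⟩
    · exact harc.elim

theorem IsMultitree.descartes (hr : IsMultitree r) (he : ∀ j, Function.Injective (e j)) :
    IsMultitree (descartesArc r e) where
  wellFounded := by
    have acc_inl (x : X) : Acc (flip (descartesArc r e)) (.inl x) := ⟨_, fun _ h => h.elim⟩
    refine ⟨?_⟩
    rintro (x | ⟨j, v⟩)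
    · exact acc_inl x
    induction v using hr.wellFounded.induction with
    | _ v ih =>
      refine ⟨_, fun z hz => ?_⟩
      rcases descartesArc_inr.mp hz with rfl | ⟨w, hvw, rfl⟩
      · exact acc_inl _
      · exact ih w hvw
  eq_of_reach := by
    have not_both {j : J} {v w : V} {z : X ⊕ J × V} (hvw : r v w)
        (hz : ReflTransGen (descartesArc r e) (.inl (e j v)) z)
        (hz' : ReflTransGen (descartesArc r e) (.inr (j, w)) z) : False := by
      obtain rfl := reach_descartesArc_inl hz
      obtain ⟨u, hwu, hu | hu⟩ := reach_descartesArc_inr hz'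
      · cases hu
      · exact hr.not_reach hvw (he j (Sum.inl_injective hu) ▸ hwu)
    rintro (x | ⟨j, v⟩) a b z ha hb haz hbz
    · exact ha.elim
    rcases descartesArc_inr.mp ha with rfl | ⟨w, hvw, rfl⟩ <;>
      rcases descartesArc_inr.mp hb with rfl | ⟨w', hvw', rfl⟩
    · rfl
    · exact (not_both hvw' haz hbz).elim
    · exact (not_both hvw hbz haz).elim
    · obtain ⟨u, hwu, hu⟩ := reach_descartesArc_inr haz
      obtain ⟨u', hwu', hu'⟩ := reach_descartesArc_inr hbz
      obtain rfl : u = u' := by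
        rcases hu with rfl | rfl <;> simpa [(he j).eq_iff] using hu'
      rw [hr.eq_of_reach hvw hvw' hwu hwu']

theorem encard_descartesArc_le {n : ℕ} (hn : ∀ v, {w | r v w}.encard ≤ n) (z : X ⊕ J × V) :
    {z' | descartesArc r e z z'}.encard ≤ (n + 1 : ℕ) := by
  rcases z with x | ⟨j, v⟩
  · simp [descartesArc]
  have heq : {z' | descartesArc r e (.inr (j, v)) z'} =
      insert (.inl (e j v)) ((fun w => .inr (j, w)) '' {w | r v w}) := by
    ext z'
    simp [descartesArc_inr, eq_comm]
  rw [heq, Nat.cast_succ]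
  exact (Set.encard_insert_le _ _).trans
    (add_le_add_left ((Set.encard_image_le _ _).trans (hn v)) 1)

theorem fromRel_descartesArc_not_colorable {n : ℕ} (hr : ¬ (SimpleGraph.fromRel r).Colorable n)
    (he : ∀ f : X → Fin (n + 1), ∃ j, ∀ v w, f (e j v) = f (e j w)) :
    ¬ (SimpleGraph.fromRel (descartesArc r e)).Colorable (n + 1) := by
  rintro ⟨c⟩
  obtain ⟨j, hj⟩ := he (c ∘ Sum.inl)
  rcases isEmpty_or_nonempty V with _ | ⟨⟨v₀⟩⟩
  · exact hr (.of_isEmpty n)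
  have avoid (v : V) : c (.inr (j, v)) ≠ c (.inl (e j v₀)) := by
    have heq : c (.inl (e j v)) = c (.inl (e j v₀)) := hj v v₀
    exact heq ▸ c.valid (by simp [descartesArc])
  refine hr ⟨⟨fun v => (finSuccAboveEquiv _).symm ⟨_, avoid v⟩, fun {v w} hvw heq => ?_⟩⟩
  refine c.valid (v := .inr (j, v)) (w := .inr (j, w)) ?_
    (by simpa using heq)
  simpa [descartesArc, SimpleGraph.fromRel_adj] using hvw

theorem isClusterMap_descartes :
    IsClusterMap (SimpleGraph.fromRel (descartesArc r e)) e (Sum.map id Prod.fst) where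
  injOn := by
    rintro (x | ⟨j, v⟩) ⟨y, hy⟩ (x' | ⟨j', v'⟩) _ hzz <;> simp_all
  eq_or_adj := by
    have key {z z'} (h : descartesArc r e z z') : Sum.map id Prod.fst z = Sum.map id Prod.fst z' ∨
        (incidenceGraph e).Adj (Sum.map id Prod.fst z) (Sum.map id Prod.fst z') := by
      rcases z with x | ⟨j, v⟩
      · exact h.elim
      rcases descartesArc_inr.mp h with rfl | ⟨w, -, rfl⟩
      · exact .inr ⟨v, rfl⟩
      · exact .inl rfl
    rintro z z' ⟨-, h | h⟩
    · exact key h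
    · exact (key h).imp Eq.symm SimpleGraph.Adj.symm
  attached_subsingleton := by
    rintro (x | ⟨j, v⟩) j' hj
    · cases hj
    · rintro (a | ⟨k, a⟩) ⟨ha, ha'⟩ (b | ⟨k', b⟩) ⟨hb, hb'⟩ <;>
        simp_all [descartesArc]

theorem isSparseOn_descartes_cluster {g : ℕ} (he : ∀ j, Function.Injective (e j))
    (hsparse : IsSparseOn (SimpleGraph.fromRel r) Set.univ g) (j : J) :
    IsSparseOn (SimpleGraph.fromRel (descartesArc r e)) {z | Sum.map id Prod.fst z = .inr j ∨
      (incidenceGraph e).Adj (Sum.map id Prod.fst z) (.inr j)} g := by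
  intro U hUj hne hU
  have copy_eq {k : J} {v : V} (hv : .inr (k, v) ∈ U) : k = j := by
    rcases hUj hv with h | h
    · exact Sum.inr_injective h
    · exact h.elim
  have no_point (x : X) : .inl x ∉ U := by
    intro hx
    obtain ⟨a, ⟨hxa, ha⟩, b, ⟨hxb, hb⟩, hab⟩ := hU _ hx
    rcases a with y | ⟨k, v⟩ <;> rcases b with y' | ⟨k', w⟩ <;>
      simp only [SimpleGraph.mem_neighborSet, SimpleGraph.fromRel_adj, descartesArc, or_self,
        and_false, false_or] at hxa hxb
    obtain rfl := copy_eq ha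
    obtain rfl := copy_eq hb
    exact hab (by rw [he k' (hxa.2.trans hxb.2.symm)])
  refine hsparse.range (fun v => .inr (j, v)) (fun v w hvw => ?_) U (fun z hz => ?_) hne hU
  · simpa [descartesArc] using hvw
  · rcases z with x | ⟨k, v⟩
    · exact absurd hz (no_point x)
    · exact ⟨v, by rw [copy_eq hz]⟩

theorem exists_multitree_not_colorable (g n : ℕ) :
    ∃ (V : Type) (_ : Finite V) (r : V → V → Prop), IsMultitree r ∧
      (∀ v, {w | r v w}.encard ≤ n) ∧ ¬ (SimpleGraph.fromRel r).Colorable n ∧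
      IsSparseOn (SimpleGraph.fromRel r) Set.univ (g + 1) := by
  induction n with
  | zero =>
    refine ⟨Unit, inferInstance, fun _ _ => False, ⟨⟨fun _ => ⟨_, fun _ h => h.elim⟩⟩, False.elim⟩,
      by simp, fun h => (h.some ()).elim0, fun U _ ⟨v, hv⟩ hU => ?_⟩
    obtain ⟨a, ⟨ha, -⟩, -⟩ := hU v hv
    simp at ha
  | succ n ih =>
    obtain ⟨V, _, r, hr, hdeg, hcol, hsparse⟩ := ih
    obtain ⟨X, J, _, _, e, he, hesparse, hmono⟩ := hasSparseRamseyHypergraphs g V (Fin (n + 1))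
    exact ⟨X ⊕ J × V, inferInstance, descartesArc r e, hr.descartes he, encard_descartesArc_le hdeg,
      fromRel_descartesArc_not_colorable hcol hmono, isClusterMap_descartes.isSparseOn hesparse
        (isSparseOn_descartes_cluster he hsparse)⟩

end Descartes

/-! ### Random independent sets -/

section Independence

universe u

open MeasureTheory MeasurableSpace ProbabilityTheory

variable {Ω W ι : Type*} {A : W → Set Ω}

theorem measurableSet_generateFrom_mono {S T : Set W} (hST : S ⊆ T) {B : Set Ω}
    (hB : MeasurableSet[generateFrom (A '' S)] B) : MeasurableSet[generateFrom (A '' T)] B :=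
  generateFrom_mono (Set.image_mono hST) _ hB

variable [MeasurableSpace Ω] {μ : Measure Ω}

theorem measurableSet_of_generateFrom (hA : ∀ x, MeasurableSet (A x)) {T : Set W} {B : Set Ω}
    (hB : MeasurableSet[generateFrom (A '' T)] B) : MeasurableSet B :=
  generateFrom_le (Set.forall_mem_image.mpr fun x _ => hA x) _ hB

theorem measure_inter_of_disjoint (hA : ∀ x, MeasurableSet (A x)) (hind : iIndepSet A μ)
    {S T : Set W} (hST : Disjoint S T) {B C : Set Ω} (hB : MeasurableSet[generateFrom (A '' S)] B)
    (hC : MeasurableSet[generateFrom (A '' T)] C) : μ (B ∩ C) = μ B * μ C :=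
  (Indep_iff _ _ μ).mp (hind.indep_generateFrom_of_disjoint hA S T hST) B C hB hC

theorem iIndepSet_of_disjoint (hA : ∀ x, MeasurableSet (A x)) (hind : iIndepSet A μ)
    {B : ι → Set Ω} {T : ι → Set W} (hT : Pairwise (Function.onFun Disjoint T))
    (hB : ∀ i, MeasurableSet[generateFrom (A '' T i)] (B i)) : iIndepSet B μ := by
  classical
  refine (iIndepSet_iff_meas_biInter fun i => measurableSet_of_generateFrom hA (hB i)).mpr
    fun s => ?_
  have := hind.isProbabilityMeasure
  induction s using Finset.induction_on with
  | empty => simp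
  | insert i s hi ih =>
    have hrest : MeasurableSet[generateFrom (A '' ⋃ j ∈ s, T j)] (⋂ j ∈ s, B j) :=
      Finset.measurableSet_biInter s fun j hj =>
        measurableSet_generateFrom_mono (Set.subset_biUnion_of_mem hj) (hB j)
    rw [Finset.set_biInter_insert, Finset.prod_insert hi, ← ih]
    refine measure_inter_of_disjoint hA hind (Set.disjoint_iUnion₂_right.mpr fun j hj => ?_)
      (hB i) hrest
    exact hT (ne_of_mem_of_not_mem hj hi).symm

theorem exists_iIndepSet {W : Type u} (q : W → ℝ) (hq : ∀ x, q x ∈ Set.Icc 0 1) :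
    ∃ (Ω : Type u) (_ : MeasurableSpace Ω) (μ : Measure Ω) (A : W → Set Ω),
      (∀ x, MeasurableSet (A x)) ∧ iIndepSet A μ ∧ ∀ x, μ.real (A x) = q x := by
  obtain ⟨Ω, _, μ, X, hX, hlaw, hind, -⟩ :=
    exists_hasLaw_indepFun (fun _ : W => Bool) fun x => bernoulliMeasure true false ⟨q x, hq x⟩
  have htrue : MeasurableSet {true} := measurableSet_singleton true
  have hmeas x : MeasurableSet (X x ⁻¹' {true}) := hX x htrue
  refine ⟨Ω, _, μ, fun x => X x ⁻¹' {true}, hmeas, ?_, fun x => ?_⟩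
  · exact (iIndepSet_iff_meas_biInter hmeas).mpr fun s =>
      hind.measure_inter_preimage_eq_mul s fun _ _ => htrue
  · rw [← map_measureReal_apply (hX x) htrue, (hlaw x).map_eq,
      bernoulliMeasure_real_apply_of_mem_of_notMem _ htrue rfl (by simp)]

end Independence

section Concentration

open MeasureTheory ProbabilityTheory

variable {Ω ι : Type*} [MeasurableSpace Ω] {μ : Measure Ω} {B : ι → Set Ω} {p η : ℝ}

theorem variance_sum_indicator_le [Fintype ι] (hind : iIndepSet B μ)
    (hB : ∀ i, MeasurableSet (B i)) :
    Var[∑ i, (B i).indicator (1 : Ω → ℝ); μ] ≤ Fintype.card ι / 4 := by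
  have := hind.isProbabilityMeasure
  have memLp i : MemLp ((B i).indicator (1 : Ω → ℝ)) 2 μ :=
    memLp_indicator_const 2 (hB i) 1 (.inr (measure_ne_top μ _))
  have variance_le i : Var[(B i).indicator (1 : Ω → ℝ); μ] ≤ ((1 - 0) / 2) ^ 2 :=
    variance_le_sq_of_bounded (.of_forall fun ω =>
      ⟨Set.indicator_nonneg (fun _ _ => zero_le_one) ω,
        Set.indicator_le_self' (fun _ _ => zero_le_one) ω⟩) (memLp i).aemeasurable
  calc Var[∑ i, (B i).indicator (1 : Ω → ℝ); μ]
      = ∑ i, Var[(B i).indicator (1 : Ω → ℝ); μ] :=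
        IndepFun.variance_sum (fun i _ => memLp i) fun i _ j _ hij =>
          hind.iIndepFun_indicator.indepFun hij
    _ ≤ ∑ _i : ι, ((1 - 0) / 2) ^ 2 := Finset.sum_le_sum fun i _ => variance_le i
    _ = Fintype.card ι / 4 := by
        simp only [Finset.sum_const, Finset.card_univ, nsmul_eq_mul]
        ring

theorem measureReal_ncard_lt_le [Finite ι] [Nonempty ι] (hind : iIndepSet B μ)
    (hB : ∀ i, MeasurableSet (B i)) (hp : ∀ i, μ.real (B i) = p) (hη : η < p) :
    μ.real {ω | ({i | ω ∈ B i}.ncard : ℝ) < η * Nat.card ι} ≤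
      1 / (4 * (p - η) ^ 2 * Nat.card ι) := by
  classical
  have := hind.isProbabilityMeasure
  have := Fintype.ofFinite ι
  generalize hk : (Nat.card ι : ℝ) = k
  have hk0 : 0 < k := hk ▸ Nat.cast_pos.mpr Nat.card_pos
  rw [Nat.card_eq_fintype_card] at hk
  have hc : 0 < (p - η) * k := mul_pos (sub_pos.mpr hη) hk0
  let X (i : ι) : Ω → ℝ := (B i).indicator 1
  have memLp i : MemLp (X i) 2 μ := memLp_indicator_const 2 (hB i) 1 (.inr (measure_ne_top μ _))
  have count_eq (ω : Ω) : (∑ i, X i) ω = {i | ω ∈ B i}.ncard := by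
    simp [X, Set.indicator_apply, Set.ncard_eq_toFinset_card']
  have mean_eq : μ[∑ i, X i] = p * k := by
    simp_rw [Finset.sum_apply]
    rw [integral_finsetSum _ fun i _ => (memLp i).integrable one_le_two]
    simp [X, integral_indicator_one (hB _), hp, hk, mul_comm]
  calc μ.real {ω | ({i | ω ∈ B i}.ncard : ℝ) < η * k}
      ≤ μ.real {ω | (p - η) * k ≤ |(∑ i, X i) ω - μ[∑ i, X i]|} := by
        refine measureReal_mono (Set.ofPred_subset_ofPred.mpr fun ω hω => ?_)
        rw [count_eq, mean_eq, le_abs]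
        right
        linarith
    _ ≤ Var[∑ i, X i; μ] / ((p - η) * k) ^ 2 :=
        ENNReal.toReal_le_of_le_ofReal (div_nonneg (variance_nonneg _ _) (sq_nonneg _))
          (meas_ge_le_variance_div_sq (memLp_finsetSum' _ fun i _ => memLp i) hc)
    _ ≤ k / 4 / ((p - η) * k) ^ 2 := by
        gcongr
        exact hk ▸ variance_sum_indicator_le hind hB
    _ = 1 / (4 * (p - η) ^ 2 * k) := by
        have := sub_pos.mpr hη
        field_simp

end Concentration

section Greedy

universe u

open Relation (ReflTransGen)
open MeasureTheory MeasurableSpace ProbabilityTheory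

variable {Ω W : Type*} {r : W → W → Prop} {A : W → Set Ω} {x : W} {p : ℝ}

/-- The event that the greedy algorithm selects a vertex `x` of a digraph: `x` passes its own
test `A x` and no out-neighbour of `x` is selected. -/
def greedyEvent (hr : WellFounded (flip r)) (A : W → Set Ω) : W → Set Ω :=
  hr.fix fun x selected => A x ∩ ⋂ y, ⋂ hxy : r x y, (selected y hxy)ᶜ

theorem greedyEvent_eq (hr : WellFounded (flip r)) (A : W → Set Ω) (x : W) :
    greedyEvent hr A x = A x ∩ ⋂ y, ⋂ _ : r x y, (greedyEvent hr A y)ᶜ :=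
  hr.fix_eq _ x

theorem not_rel_of_mem_greedyEvent (hr : WellFounded (flip r)) {y : W} {ω : Ω}
    (hx : ω ∈ greedyEvent hr A x) (hy : ω ∈ greedyEvent hr A y) : ¬ r x y := by
  rw [greedyEvent_eq] at hx
  exact fun hxy => Set.mem_iInter₂.mp hx.2 y hxy hy

variable [Countable W]

theorem measurableSet_generateFrom_greedyEvent (hr : WellFounded (flip r)) (A : W → Set Ω)
    (x : W) :
    MeasurableSet[generateFrom (A '' {z | ReflTransGen r x z})] (greedyEvent hr A x) := by
  induction x using hr.induction with
  | _ x ih =>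
    rw [greedyEvent_eq]
    exact .inter (measurableSet_generateFrom ⟨x, .refl, rfl⟩) <| .iInter fun y => .iInter fun hxy =>
      measurableSet_generateFrom_mono (fun z hyz => .head hxy hyz) (ih y hxy).compl

variable [MeasurableSpace Ω] {μ : Measure Ω}

theorem iIndepSet_greedyEvent {ι : Type*} (hr : WellFounded (flip r))
    (hA : ∀ x, MeasurableSet (A x)) (hind : iIndepSet A μ) {f : ι → W}
    (hf : Pairwise fun i j => Disjoint {z | ReflTransGen r (f i) z} {z | ReflTransGen r (f j) z}) :
    iIndepSet (fun i => greedyEvent hr A (f i)) μ :=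
  iIndepSet_of_disjoint hA hind hf fun i => measurableSet_generateFrom_greedyEvent hr A (f i)

theorem measure_greedyEvent_eq_mul_prod (hr : IsMultitree r) (hA : ∀ x, MeasurableSet (A x))
    (hind : iIndepSet A μ) (x : W) [Fintype {y | r x y}] :
    μ (greedyEvent hr.wellFounded A x) =
      μ (A x) * ∏ y : {y | r x y}, μ (greedyEvent hr.wellFounded A y)ᶜ := by
  have hmeas y := (measurableSet_generateFrom_greedyEvent hr.wellFounded A y).compl
  let T (y : {y | r x y}) : Set W := {z | ReflTransGen r y z}
  have hT : Pairwise (Function.onFun Disjoint T) := fun y y' hne =>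
    Set.disjoint_left.mpr fun z hyz hyz' =>
      hne (Subtype.ext (hr.eq_of_reach y.2 y'.2 hyz hyz'))
  have hx : Disjoint {x} (⋃ y, T y) :=
    Set.disjoint_singleton_left.mpr fun h => by
      obtain ⟨y, hyx⟩ := Set.mem_iUnion.mp h
      exact hr.not_reach y.2 hyx
  have hinter : MeasurableSet[generateFrom (A '' ⋃ y, T y)]
      (⋂ y : {y | r x y}, (greedyEvent hr.wellFounded A y)ᶜ) := .iInter fun y =>
    measurableSet_generateFrom_mono (Set.subset_iUnion T y) (hmeas y)
  have hprod := (iIndepSet_of_disjoint hA hind hT fun y => hmeas y).meas_biInter Finset.univ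
  simp only [Finset.mem_univ, Set.iInter_true] at hprod
  rw [← hprod, ← measure_inter_of_disjoint hA hind hx (measurableSet_generateFrom ⟨x, rfl, rfl⟩)
    hinter, greedyEvent_eq, Set.iInter_subtype]
  rfl

theorem measureReal_greedyEvent (hr : IsMultitree r) (hA : ∀ x, MeasurableSet (A x))
    (hind : iIndepSet A μ) (hfin : ∀ x, {y | r x y}.Finite)
    (hp : ∀ x, μ.real (A x) * (1 - p) ^ {y | r x y}.ncard = p) (x : W) :
    μ.real (greedyEvent hr.wellFounded A x) = p := by
  have := hind.isProbabilityMeasure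
  have hmeas y := measurableSet_of_generateFrom hA
    (measurableSet_generateFrom_greedyEvent hr.wellFounded A y)
  induction x using hr.wellFounded.induction with
  | _ x ih =>
    have := (hfin x).fintype
    calc μ.real (greedyEvent hr.wellFounded A x)
        = μ.real (A x) * ∏ y : {y | r x y}, μ.real (greedyEvent hr.wellFounded A y)ᶜ := by
          simp only [Measure.real, measure_greedyEvent_eq_mul_prod hr hA hind x,
            ENNReal.toReal_mul, ENNReal.toReal_prod]
      _ = μ.real (A x) * ∏ _y : {y | r x y}, (1 - p) := by
          congr! 2 with y
          rw [probReal_compl_eq_one_sub (hmeas y), ih y y.2]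
      _ = p := by
          rw [Finset.prod_const, Finset.card_univ, ← Nat.card_eq_fintype_card,
            Nat.card_coe_set_eq, hp]

theorem exists_random_independent_set {W : Type u} [Countable W] {r : W → W → Prop}
    (hr : IsMultitree r) {D : ℕ} (hD : ∀ x, {y | r x y}.encard ≤ D) (hp0 : 0 ≤ p) (hp1 : p < 1)
    (hpD : p ≤ (1 - p) ^ D) :
    ∃ (Ω : Type u) (_ : MeasurableSpace Ω) (μ : Measure Ω) (B : W → Set Ω),
      IsProbabilityMeasure μ ∧ (∀ x, MeasurableSet (B x)) ∧ (∀ x, μ.real (B x) = p) ∧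
      (∀ x y, r x y → Disjoint (B x) (B y)) ∧
      ∀ s : Set W, (s.Pairwise fun x y =>
        Disjoint {z | ReflTransGen r x z} {z | ReflTransGen r y z}) →
        iIndepSet (fun x : s => B x) μ := by
  have hfin x : {y | r x y}.Finite := Set.finite_of_encard_le_coe (hD x)
  have hpow x : p ≤ (1 - p) ^ {y | r x y}.ncard := by
    refine hpD.trans (pow_le_pow_of_le_one (sub_nonneg.mpr hp1.le) (sub_le_self 1 hp0) ?_)
    exact_mod_cast (hfin x).cast_ncard_eq.trans_le (hD x)
  have hpos x : 0 < (1 - p) ^ {y | r x y}.ncard := pow_pos (sub_pos.mpr hp1) _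
  -- `x` must be selected with probability `p`, given that no out-neighbour is
  obtain ⟨Ω, _, μ, A, hA, hind, hμA⟩ := exists_iIndepSet
    (fun x => p / (1 - p) ^ {y | r x y}.ncard) fun x =>
      ⟨div_nonneg hp0 (hpos x).le, (div_le_one (hpos x)).mpr (hpow x)⟩
  refine ⟨Ω, _, μ, greedyEvent hr.wellFounded A, hind.isProbabilityMeasure, fun x =>
    measurableSet_of_generateFrom hA (measurableSet_generateFrom_greedyEvent hr.wellFounded A x),
    measureReal_greedyEvent hr hA hind hfin fun x => ?_, fun x y hxy =>
    Set.disjoint_left.mpr fun ω hx hy => not_rel_of_mem_greedyEvent hr.wellFounded hx hy hxy,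
    fun s hs => iIndepSet_greedyEvent hr.wellFounded hA hind fun x y hne =>
      hs x.2 y.2 (Subtype.coe_ne_coe.mpr hne)⟩
  rw [hμA, div_mul_cancel₀ _ (hpos x).ne']

theorem exists_independent_set_large_inter {W ι : Type*} [Countable W] [Finite ι]
    {r : W → W → Prop} (hr : IsMultitree r) {D : ℕ} (hD : ∀ x, {y | r x y}.encard ≤ D)
    {η : ℝ} (hp0 : 0 ≤ p) (hp1 : p < 1) (hpD : p ≤ (1 - p) ^ D) (hη : η < p) {k : ℕ}
    (hk : Nat.card ι < 4 * (p - η) ^ 2 * k) {L : ι → Set W} (hL : ∀ u, (L u).ncard = k)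
    (hdisj : ∀ u, (L u).Pairwise fun x y =>
      Disjoint {z | ReflTransGen r x z} {z | ReflTransGen r y z}) :
    ∃ S : Set W, (∀ x ∈ S, ∀ y ∈ S, ¬ r x y) ∧ ∀ u, η * k ≤ (S ∩ L u).ncard := by
  obtain ⟨Ω, _, μ, B, _, hB, hμB, hrB, hind⟩ := exists_random_independent_set hr hD hp0 hp1 hpD
  have := Fintype.ofFinite ι
  have hpos : 0 < 4 * (p - η) ^ 2 * k := (Nat.cast_nonneg _).trans_lt hk
  have hk0 : 0 < k := Nat.pos_of_ne_zero fun h => by simp [h] at hpos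
  let bad (u : ι) : Set Ω := {ω | ({x : L u | ω ∈ B x}.ncard : ℝ) < η * k}
  have measure_bad (u : ι) : μ.real (bad u) ≤ 1 / (4 * (p - η) ^ 2 * k) := by
    have : Finite (L u) := Set.finite_of_ncard_pos (hL u ▸ hk0)
    have : Nonempty (L u) := (Set.nonempty_of_ncard_ne_zero (hL u ▸ hk0.ne')).to_subtype
    have := measureReal_ncard_lt_le (hind (L u) (hdisj u)) (fun x => hB x) (fun x => hμB x) hη
    rwa [Nat.card_coe_set_eq, hL] at this
  have union_bound : μ.real (⋃ u, bad u) < 1 :=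
    calc μ.real (⋃ u, bad u) ≤ ∑ u, μ.real (bad u) := measureReal_iUnion_fintype_le _
      _ ≤ ∑ _u : ι, 1 / (4 * (p - η) ^ 2 * k) := Finset.sum_le_sum fun u _ => measure_bad u
      _ = Nat.card ι / (4 * (p - η) ^ 2 * k) := by simp [div_eq_mul_inv]
      _ < 1 := (div_lt_one hpos).mpr hk
  obtain ⟨ω, hω⟩ : (⋃ u, bad u)ᶜ.Nonempty := Set.nonempty_compl.mpr fun h => by
    simp [h] at union_bound
  refine ⟨{x | ω ∈ B x}, fun x hx y hy hxy => Set.disjoint_left.mp (hrB x y hxy) hx hy,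
    fun u => ?_⟩
  have good : ω ∉ bad u := fun h => hω (Set.mem_iUnion_of_mem u h)
  rw [Set.mem_ofPred_eq, not_lt] at good
  rwa [Set.inter_comm, ← Subtype.image_preimage_coe,
    Set.ncard_image_of_injective _ Subtype.val_injective]

end Greedy

/-! ### Colourings of covers -/

section Cover

open Relation (ReflTransGen)

namespace DPCover

variable {V W : Type*} {G : SimpleGraph V}

/-- The vertex of `G` whose list contains the vertex `x` of the cover. -/
noncomputable def base (C : DPCover G W) (x : W) : V :=
  (C.partition x).choose

theorem mem_L_base (C : DPCover G W) (x : W) : x ∈ C.L (C.base x) :=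
  (C.partition x).choose_spec.1

theorem base_eq_of_mem {C : DPCover G W} {x : W} {u : V} (h : x ∈ C.L u) : C.base x = u :=
  (C.partition x).unique (C.mem_L_base x) h

theorem eq_of_adj_of_base_eq {C : DPCover G W} {x y y' : W} (hadj : G.Adj (C.base x) (C.base y))
    (hbase : C.base y = C.base y') (hxy : C.H.Adj x y) (hxy' : C.H.Adj x y') : y = y' :=
  C.matching _ _ hadj x (C.mem_L_base x) y (C.mem_L_base y) y' (hbase ▸ C.mem_L_base y') hxy hxy'

variable {r : V → V → Prop}

/-- The lift to the cross-edges of a cover of an orientation `r` of the covered graph. -/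
def liftArc (C : DPCover G W) (r : V → V → Prop) (x y : W) : Prop :=
  r (C.base x) (C.base y) ∧ C.H.Adj x y

theorem reach_base {C : DPCover G W} {x y : W} (h : ReflTransGen (C.liftArc r) x y) :
    ReflTransGen r (C.base x) (C.base y) :=
  h.lift C.base fun _ _ harc => harc.1

variable {C : DPCover (SimpleGraph.fromRel r) W}

theorem eq_of_liftArc (hr : IsMultitree r) {x y y' : W} (h : C.liftArc r x y)
    (h' : C.liftArc r x y') (hbase : C.base y = C.base y') : y = y' :=
  eq_of_adj_of_base_eq (hr.fromRel_adj_of_rel h.1) hbase h.2 h'.2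

theorem eq_of_reach_of_base_eq (hr : IsMultitree r) {x x' z : W} (hbase : C.base x = C.base x')
    (hz : ReflTransGen (C.liftArc r) x z) (hz' : ReflTransGen (C.liftArc r) x' z) : x = x' := by
  have not_reach {x x' y : W} (hbase : C.base x = C.base x') (hxy : C.liftArc r x y) :
      ¬ ReflTransGen (C.liftArc r) y x' := fun h =>
    hr.not_reach hxy.1 (hbase ▸ reach_base h)
  induction hu : C.base x using hr.wellFounded.induction generalizing x x' with
  | _ u ih =>
    rcases hz.cases_head with rfl | ⟨y, hxy, hyz⟩
    · rcases hz'.cases_head with h | ⟨y', hxy', hyz'⟩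
      · exact h.symm
      · exact absurd hyz' (not_reach hbase.symm hxy')
    · rcases hz'.cases_head with rfl | ⟨y', hxy', hyz'⟩
      · exact absurd hyz (not_reach hbase hxy)
      · have hyy' : C.base y = C.base y' :=
          hr.eq_of_reach hxy.1 (hbase ▸ hxy'.1) (reach_base hyz) (reach_base hyz')
        obtain rfl : y = y' := ih (C.base y) (hu ▸ hxy.1) hyy' hyz hyz' rfl
        exact eq_of_adj_of_base_eq (hr.fromRel_adj_of_rel hxy.1).symm hbase hxy.2.symm hxy'.2.symm

theorem isMultitree_liftArc (hr : IsMultitree r) (C : DPCover (SimpleGraph.fromRel r) W) :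
    IsMultitree (C.liftArc r) where
  wellFounded := Subrelation.wf (fun h => h.1) (InvImage.wf C.base hr.wellFounded)
  eq_of_reach hxy hxy' hz hz' :=
    eq_of_reach_of_base_eq hr (hr.eq_of_reach hxy.1 hxy'.1 (reach_base hz) (reach_base hz')) hz hz'

theorem encard_liftArc_le (hr : IsMultitree r) (C : DPCover (SimpleGraph.fromRel r) W) (x : W) :
    {y | C.liftArc r x y}.encard ≤ {v | r (C.base x) v}.encard :=
  Set.encard_le_encard_of_injOn (fun _ h => h.1) fun _ h _ h' => eq_of_liftArc hr h h'

theorem isQuasiIndep_of_not_liftArc {S : Set W} (hS : ∀ x ∈ S, ∀ y ∈ S, ¬ C.liftArc r x y) :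
    C.IsQuasiIndep S := by
  rintro x hx y hy ⟨hxy, u, v, huv, hxu, hyv⟩
  have hadj := (C.eq_or_adj u v x hxu y hyv hxy).resolve_left huv
  rw [← base_eq_of_mem hxu, ← base_eq_of_mem hyv] at hadj
  rcases hadj.2 with h | h
  · exact hS x hx y hy ⟨h, hxy⟩
  · exact hS y hy x hx ⟨h, hxy.symm⟩

theorem exists_isFracColoring [Finite V] [Countable W] (hr : IsMultitree r) {D : ℕ}
    (hD : ∀ v, {w | r v w}.encard ≤ D) {p η : ℝ} (hp0 : 0 ≤ p) (hp1 : p < 1)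
    (hpD : p ≤ (1 - p) ^ D) (hη : η < p) {k : ℕ} (hk : Nat.card V < 4 * (p - η) ^ 2 * k)
    (hC : C.IsFold k) : ∃ S : Set W, C.IsFracColoring η S := by
  obtain ⟨S, hS, hSL⟩ := exists_independent_set_large_inter (isMultitree_liftArc hr C)
    (fun x => (encard_liftArc_le hr C x).trans (hD _)) hp0 hp1 hpD hη hk hC
    fun u x hx y hy hne => Set.disjoint_left.mpr fun z hz hz' => hne <|
      eq_of_reach_of_base_eq hr ((base_eq_of_mem hx).trans (base_eq_of_mem hy).symm) hz hz'
  exact ⟨S, isQuasiIndep_of_not_liftArc hS, fun u => hC u ▸ hSL u⟩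

end DPCover

open Filter in
theorem IsMultitree.fracDPChromaticNumber_le {V : Type*} [Finite V] {r : V → V → Prop}
    (hr : IsMultitree r) {D : ℕ} (hD : ∀ v, {w | r v w}.encard ≤ D) {p : ℝ} (hp0 : 0 < p)
    (hp1 : p < 1) (hpD : p ≤ (1 - p) ^ D) :
    fracDPChromaticNumber (SimpleGraph.fromRel r) ≤ ENNReal.ofReal p⁻¹ := by
  have le_of_lt {η : ℝ} (hη0 : 0 < η) (hη : η < p) :
      fracDPChromaticNumber (SimpleGraph.fromRel r) ≤ ENNReal.ofReal η⁻¹ := by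
    have hpos : 0 < 4 * (p - η) ^ 2 := by have := sub_pos.mpr hη; positivity
    obtain ⟨k, hk⟩ := exists_nat_gt (Nat.card V / (4 * (p - η) ^ 2))
    have hk0 : 0 < k := by exact_mod_cast (div_nonneg (Nat.cast_nonneg _) hpos.le).trans_lt hk
    rw [div_lt_iff₀' hpos] at hk
    have hθ : η ≤ thetaDP (SimpleGraph.fromRel r) k :=
      le_csSup ⟨1, fun _ h => h.1.2⟩ ⟨⟨hη0.le, (hη.trans hp1).le⟩, fun W _ C hC =>
        DPCover.exists_isFracColoring hr hD hp0.le hp1 hpD hη hk hC⟩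
    rw [ENNReal.ofReal_inv_of_pos hη0]
    exact (iInf_le _ (⟨k, hk0⟩ : ℕ+)).trans (ENNReal.inv_le_inv.mpr (ENNReal.ofReal_le_ofReal hθ))
  have hlim : Tendsto (fun η : ℝ => ENNReal.ofReal η⁻¹) (nhdsWithin p (Set.Iio p))
      (nhds (ENNReal.ofReal p⁻¹)) :=
    (ENNReal.tendsto_ofReal (tendsto_inv₀ hp0.ne')).mono_left nhdsWithin_le_nhds
  refine ge_of_tendsto hlim ?_
  filter_upwards [Ioo_mem_nhdsLT hp0] with η hη using le_of_lt hη.1 hη.2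

end Cover

/-! ### Selection probabilities -/

section Asymptotics

open Filter Real

/-- The odds `p / (1 - p)` of the selection probability used for out-degree at most `d`, chosen such
that `exp (d * selectionOdds d) = d / (1 + log d)`. -/
noncomputable def selectionOdds (d : ℕ) : ℝ := (log d - log (1 + log d)) / d

theorem selectionOdds_pos {d : ℕ} (hd : 2 ≤ d) : 0 < selectionOdds d := by
  have hd0 : (0 : ℝ) < d := by positivity
  have hlog : log d < d - 1 := log_lt_sub_one_of_pos hd0 (by norm_cast; lia)
  have hlog0 : 0 ≤ log d := log_natCast_nonneg d
  exact div_pos (sub_pos.mpr (log_lt_log (by linarith) (by linarith))) hd0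

theorem selectionOdds_mul_pow_le_one {d : ℕ} (hd : 2 ≤ d) :
    selectionOdds d * (1 + selectionOdds d) ^ d ≤ 1 := by
  have hx := selectionOdds_pos hd
  have hd0 : (0 : ℝ) < d := by positivity
  have hlog0 : 0 ≤ log d := log_natCast_nonneg d
  have hlog1 : 0 < 1 + log d := by linarith
  have hexp : exp (d * selectionOdds d) = d / (1 + log d) := by
    rw [selectionOdds, mul_div_cancel₀ _ hd0.ne', exp_sub, exp_log hd0, exp_log hlog1]
  calc selectionOdds d * (1 + selectionOdds d) ^ d
      ≤ selectionOdds d * exp (d * selectionOdds d) := by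
        rw [exp_nat_mul, add_comm]
        gcongr
        exact add_one_le_exp _
    _ = (log d - log (1 + log d)) / (1 + log d) := by
        rw [hexp, selectionOdds]
        field_simp
    _ ≤ 1 := (div_le_one hlog1).mpr (by linarith [log_nonneg (le_add_of_nonneg_right hlog0)])

theorem tendsto_log_natCast_div : Tendsto (fun d : ℕ => log d / d) atTop (nhds 0) :=
  isLittleO_log_id_atTop.tendsto_div_nhds_zero.comp tendsto_natCast_atTop_atTop

theorem tendsto_log_div_mul_inv_selectionOdds :
    Tendsto (fun d : ℕ => log d / d * (selectionOdds d)⁻¹) atTop (nhds 1) := by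
  have hlog : Tendsto (fun d : ℕ => log d) atTop atTop :=
    tendsto_log_atTop.comp tendsto_natCast_atTop_atTop
  have hone : Tendsto (fun t : ℝ => log (1 + t) / t) atTop (nhds 0) := by
    have := (tendsto_pow_log_div_mul_add_atTop 1 (-1) 1 one_ne_zero).comp
      (tendsto_atTop_add_const_left atTop 1 tendsto_id)
    refine this.congr fun t => ?_
    simp
  have hlim : Tendsto (fun d : ℕ => (1 - log (1 + log d) / log d)⁻¹) atTop (nhds 1) := by
    simpa using ((hone.comp hlog).const_sub 1).inv₀ (by simp)
  refine hlim.congr' ?_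
  filter_upwards [eventually_ge_atTop 2] with d hd
  have : (0 : ℝ) < d := by positivity
  have hlog0 : 0 < log d := log_pos (by exact_mod_cast hd)
  rw [selectionOdds, one_sub_div hlog0.ne', inv_div, inv_div]
  field_simp

/-- The selection probability for out-degree at most `d`, asymptotic to `log d / d`. -/
noncomputable def selectionProb (d : ℕ) : ℝ := selectionOdds d / (1 + selectionOdds d)

theorem selectionProb_pos {d : ℕ} (hd : 2 ≤ d) : 0 < selectionProb d := by
  have := selectionOdds_pos hd
  unfold selectionProb
  positivity

theorem one_sub_selectionProb {d : ℕ} (hd : 2 ≤ d) :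
    1 - selectionProb d = (1 + selectionOdds d)⁻¹ := by
  have := selectionOdds_pos hd
  unfold selectionProb
  field_simp
  ring

theorem selectionProb_lt_one {d : ℕ} (hd : 2 ≤ d) : selectionProb d < 1 := by
  have := selectionOdds_pos hd
  rw [← sub_pos, one_sub_selectionProb hd]
  positivity

theorem selectionProb_le_one_sub_pow {d : ℕ} (hd : 2 ≤ d) :
    selectionProb d ≤ (1 - selectionProb d) ^ d := by
  have hx := selectionOdds_pos hd
  rw [one_sub_selectionProb hd, inv_pow, ← one_div, le_div_iff₀ (by positivity)]
  calc selectionProb d * (1 + selectionOdds d) ^ d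
      ≤ selectionOdds d * (1 + selectionOdds d) ^ d := by
        gcongr
        exact div_le_self hx.le (le_add_of_nonneg_right hx.le)
    _ ≤ 1 := selectionOdds_mul_pow_le_one hd

theorem tendsto_log_div_mul_inv_selectionProb :
    Tendsto (fun d : ℕ => log d / d * (selectionProb d)⁻¹) atTop (nhds 1) := by
  have h := tendsto_log_div_mul_inv_selectionOdds.add tendsto_log_natCast_div
  rw [add_zero] at h
  refine h.congr' ?_
  filter_upwards [eventually_ge_atTop 2] with d hd
  have := selectionOdds_pos hd
  rw [selectionProb, inv_div, add_div, div_self this.ne', one_div, mul_add, mul_one]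

end Asymptotics

theorem corollary1p8 :
    ∃ ε : ℕ → ℝ, Filter.Tendsto ε Filter.atTop (nhds 0) ∧
      ∀ d g : ℕ, 1 ≤ d → 1 ≤ g →
        ∃ (V : Type) (_ : Finite V) (G : SimpleGraph V),
          (d : ℕ∞) ≤ G.chromaticNumber ∧ (g : ℕ∞) ≤ G.egirth ∧
          (2 ≤ d → fracDPChromaticNumber G ≤
            ENNReal.ofReal ((1 + ε d) * ((d : ℝ) / Real.log d))) := by
  refine ⟨fun d => Real.log d / d * (selectionProb d)⁻¹ - 1, ?_, fun d g hd _ => ?_⟩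
  · simpa using tendsto_log_div_mul_inv_selectionProb.sub_const 1
  obtain ⟨n, rfl⟩ := Nat.exists_eq_add_of_le' hd
  obtain ⟨V, hV, r, hr, hdeg, hcol, hsparse⟩ := exists_multitree_not_colorable g n
  refine ⟨V, hV, SimpleGraph.fromRel r, ?_, le_trans (by simp) hsparse.le_egirth, fun hd2 => ?_⟩
  · rw [← SimpleGraph.chromaticNumber_le_iff_colorable, not_le] at hcol
    exact_mod_cast Order.add_one_le_of_lt hcol
  · have hdeg' v : {w | r v w}.encard ≤ (n + 1 : ℕ) := (hdeg v).trans (by simp)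
    have hlog : Real.log (n + 1 : ℕ) ≠ 0 := (Real.log_pos (by exact_mod_cast hd2)).ne'
    refine (hr.fracDPChromaticNumber_le hdeg' (selectionProb_pos hd2) (selectionProb_lt_one hd2)
      (selectionProb_le_one_sub_pow hd2)).trans_eq (congrArg ENNReal.ofReal ?_)
    rw [add_sub_cancel]
    field_simp
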